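/- Consider a discounted Markov decision process with finite state set $\mathcal S$, finite action set $\mathcal A$, random rewards $\mathcal R(s,a)$ with values in $[0,1]$, transition probabilities $\mathcal P(\cdot\mid s,a)$ and discount factor $\gamma\in(0,1)$. For a policy $\pi$ (for each state $s$ a probability distribution $\pi(\cdot\mid s)$ on $\mathcal A$) let $$V^\pi(s)=\mathbb E\Big[\sum_{t\ge0}\gamma^t\mathcal R(S_t,A_t)\,\Big|\,S_0=s\Big],\qquad Q^\pi(s,a)=\mathbb E\Big[\sum_{t\ge0}\gamma^t\mathcal R(S_t,A_t)\,\Big|\,S_0=s,A_0=a\Big],$$ where $A_t\sim\pi(\cdot\mid S_t)$ (for $t\geq 1$ in the definition of $Q^\pi$) and $S_{t+1}\sim\mathcal P(\cdot\mid S_t,A_t)$. Let $\rho$ be a probability distribution on $\mathcal S$, $V^\pi(\rho)=\sum_s\rho(s)V^\pi(s)$, let $\pi^\star$ be a policy that maximizes $V^{\pi}(\rho)$ over all policies, and $V^\star=V^{\pi^\star}$. Let $\mathcal A^\pi_s=\arg\max_aQ^\pi(s,a)$ and $\Delta^\pi(s)=\max_aQ^\pi(s,a)-\max_{a\notin\mathcal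 A^\pi_s}Q^\pi(s,a)$, with $\Delta^\pi(s)=+\infty$ and $1/\Delta^\pi(s)=0$ if $\mathcal A^\pi_s=\mathcal A$. Adaptive natural policy gradient (NPG) with parameters $L_k>0$ starts at $\pi_0(a\mid s)=1/|\mathcal A|$ and iterates $$\pi_{k+1}(a\mid s)=\frac{\pi_k(a\mid s)\exp(\eta_kQ^{\pi_k}(s,a))}{\sum_{a'}\pi_k(a'\mid s)\exp(\eta_kQ^{\pi_k}(s,a'))}$$ with any step sizes satisfying $$\eta_k\ge\Big(L_k+\log\frac{|\mathcal A|}{\pi_k(a\mid s)}\Big)\frac1{\Delta^{\pi_k}(s)}\qquad\text{for all }s\in\mathcal S,\ a\in\mathcal A^{\pi_k}_s .$$ Let $T_\pi=\gamma P_\pi-I$ with $[P_\pi]_{s,s'}=\sum_a\mathcal P(s'\mid s,a)\pi(a\mid s)$, let $\|v\|_\rho=\sum_s\rho(s)|v(s)|$ for $v\in\mathbb R^{\mathcal S}$ and $\|T\|_\rho=\sup_{\|v\|_\rho\le1}\|Tv\|_\rho\in[0,\infty]$ for a matrix $T$. Theorem. Let $p\in(1,2]$, $L>0$, and let $(\pi_k)_{k\ge0}$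 be the iterates of adaptive NPG with $L_k=Lp^k$. Assume that there are $0<\tilde L,M<\infty$ with $$\|T_{\pi_k}-T_{\pi^\star}\|_\rho\le\tilde L\,\|V^{\pi_k}-V^\star\|_\rho^{p-1},\qquad\|T_{\pi_k}^{-1}\|_\rho\le M\qquad\text{for all }k\ge0 .$$ Let $b=\tilde LM$, $\kappa=\frac{\log b}{p-1}+\frac{p\log p}{(p-1)^2}$ and $\kappa^+=\max\{\kappa,0\}$. Then for all $k\ge0$ $$|V^\star(\rho)-V^{\pi_k}(\rho)|\le\exp\big(p^k\kappa^+\big)\Big(|V^\star(\rho)-V^{\pi_0}(\rho)|^{p^k}+k\exp\big(p^k(-\log(1-\gamma)-L)\big)\Big).$$ Moreover, if $$\log|V^\star(\rho)-V^{\pi_0}(\rho)|<-\kappa\qquad\text{and}\qquad L>\kappa-\log(1-\gamma)$$ (with $\log0=-\infty$), then $V^{\pi_k}(\rho)$ converges to $V^\star(\rho)$ super-linearly with order $p$ (quadratically if $p=2$): there are positive numbers $\varepsilon_k\to0$ and a constant $\mu$ with $|V^\star(\rho)-V^{\pi_k}(\rho)|\le\varepsilon_k$ and $\varepsilon_{k+1}\le\mu\,\varepsilon_k^{\,p}$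 for all $k\ge0$. -/

import Mathlib

open MeasureTheory ProbabilityTheory

/-- The probability measure on a finite type whose masses are the coordinates of `w`. -/
noncomputable def simplexMeasure {ι : Type*} [Fintype ι] [MeasurableSpace ι]
    (w : stdSimplex ℝ ι) : Measure ι :=
  ∑ i, ENNReal.ofReal (w i) • Measure.dirac i

instance simplexMeasure_isProbabilityMeasure {ι : Type*} [Fintype ι] [MeasurableSpace ι]
    (w : stdSimplex ℝ ι) : IsProbabilityMeasure (simplexMeasure w) := by
  constructor
  have h : ∑ i, ENNReal.ofReal (w i) = 1 := by
    refine (ENNReal.ofReal_sum_of_nonneg (fun i _ => w.2.1 i)).symm.trans ?_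
    exact (congrArg ENNReal.ofReal w.2.2).trans ENNReal.ofReal_one
  simpa [simplexMeasure] using h

/-- A discounted Markov decision process with state space `S` and action space `A`.  Rewards are
random: `reward s a` is the law of `R(s, a)`, a probability measure on `[0, 1]`. -/
structure DiscountedMDP (S A : Type*) [Fintype S] where
  reward : S → A → ProbabilityMeasure unitInterval
  trans : S → A → stdSimplex ℝ S
  discount : ℝ
  discount_pos : 0 < discount
  discount_lt_one : discount < 1

/-- A stationary randomized policy: `π s a` is the probability of action `a` in state `s`. -/
abbrev Policy (S A : Type*) [Fintype A] : Type _ := S → stdSimplex ℝ A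

namespace DiscountedMDP

variable {S A : Type*} [Fintype S] [Fintype A]

section Trajectories

variable [MeasurableSpace S] [MeasurableSpace A]

/-- Law of `(S, A, R)` when `S = s` and `A = a` are given and `R` is drawn from `reward s a`. -/
noncomputable def lawOfStateAction (mdp : DiscountedMDP S A) (s : S) (a : A) :
    Measure (S × A × unitInterval) :=
  (mdp.reward s a : Measure unitInterval).map (fun r => (s, a, r))

/-- Law of `(S, A, R)` when `S = s`, `A` is drawn from `π s` and `R` from `reward S A`. -/
noncomputable def lawOfState [MeasurableSingletonClass A] (mdp : DiscountedMDP S A)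
    (π : Policy S A) (s : S) : Measure (S × A × unitInterval) :=
  (simplexMeasure (π s)).bind (mdp.lawOfStateAction s)

/-- Law of `(S', A', R')` one step after the state-action pair `(s, a)`: the state `S'` is drawn
from `trans s a`, and then `A'` and `R'` as in `lawOfState`. -/
noncomputable def nextLaw [MeasurableSingletonClass A] (mdp : DiscountedMDP S A)
    (π : Policy S A) (s : S) (a : A) : Measure (S × A × unitInterval) :=
  (simplexMeasure (mdp.trans s a)).bind (mdp.lawOfState π)

variable [MeasurableSingletonClass S] [MeasurableSingletonClass A]

instance lawOfStateAction_isProbabilityMeasure (mdp : DiscountedMDP S A) (s : S) (a : A) :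
    IsProbabilityMeasure (mdp.lawOfStateAction s a) :=
  Measure.isProbabilityMeasure_map (by fun_prop)

instance lawOfState_isProbabilityMeasure (mdp : DiscountedMDP S A) (π : Policy S A) (s : S) :
    IsProbabilityMeasure (mdp.lawOfState π s) := by
  constructor
  rw [lawOfState, Measure.bind_apply MeasurableSet.univ (measurable_of_countable _).aemeasurable]
  simp

instance nextLaw_isProbabilityMeasure (mdp : DiscountedMDP S A) (π : Policy S A) (s : S) (a : A) :
    IsProbabilityMeasure (mdp.nextLaw π s a) := by
  constructor
  rw [nextLaw, Measure.bind_apply MeasurableSet.univ (measurable_of_countable _).aemeasurable]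
  simp

/-- The one-step transition kernel of the process `(S_t, A_t, R_t)` under the policy `π`. -/
noncomputable def stepKernel (mdp : DiscountedMDP S A) (π : Policy S A) :
    Kernel (S × A × unitInterval) (S × A × unitInterval) :=
  (Kernel.ofFunOfCountable (fun x : S × A => mdp.nextLaw π x.1 x.2)).comap
    (fun x => (x.1, x.2.1)) (by fun_prop)

instance stepKernel_isMarkovKernel (mdp : DiscountedMDP S A) (π : Policy S A) :
    IsMarkovKernel (mdp.stepKernel π) :=
  ⟨fun x => mdp.nextLaw_isProbabilityMeasure π x.1 x.2.1⟩

/-- The law of the whole trajectory `(S_t, A_t, R_t)_{t ≥ 0}` under the policy `π`, when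
`(S_0, A_0, R_0)` has law `μ₀`. -/
noncomputable def trajectoryLaw (mdp : DiscountedMDP S A) (π : Policy S A)
    (μ₀ : Measure (S × A × unitInterval)) : Measure (ℕ → S × A × unitInterval) :=
  Kernel.trajMeasure (X := fun _ => S × A × unitInterval) μ₀
    (fun n => (mdp.stepKernel π).comap (fun h => h ⟨n, Finset.mem_Iic.2 le_rfl⟩) (by fun_prop))

/-- The discounted sum of rewards `∑ γ^t R_t` along a trajectory. -/
noncomputable def discountedReturn (mdp : DiscountedMDP S A)
    (ω : ℕ → S × A × unitInterval) : ℝ :=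
  ∑' t, mdp.discount ^ t * ((ω t).2.2 : ℝ)

/-- The value function `V^π(s)`. -/
noncomputable def V (mdp : DiscountedMDP S A) (π : Policy S A) (s : S) : ℝ :=
  ∫ ω, mdp.discountedReturn ω ∂(mdp.trajectoryLaw π (mdp.lawOfState π s))

/-- The state-action value function `Q^π(s, a)`. -/
noncomputable def Q (mdp : DiscountedMDP S A) (π : Policy S A) (s : S) (a : A) : ℝ :=
  ∫ ω, mdp.discountedReturn ω ∂(mdp.trajectoryLaw π (mdp.lawOfStateAction s a))

/-- The average value `V^π(ρ) = E_{s ∼ ρ}[V^π(s)]`. -/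
noncomputable def avgV (mdp : DiscountedMDP S A) (ρ : stdSimplex ℝ S) (π : Policy S A) : ℝ :=
  ∑ s, ρ s * mdp.V π s

/-- `π` maximizes `V^π(ρ)` over all policies. -/
def IsOptimal (mdp : DiscountedMDP S A) (ρ : stdSimplex ℝ S) (π : Policy S A) : Prop :=
  ∀ π' : Policy S A, mdp.avgV ρ π' ≤ mdp.avgV ρ π

/-- The set of actions that maximize `Q^π(s, ·)`. -/
def greedyActions (mdp : DiscountedMDP S A) (π : Policy S A) (s : S) : Set A :=
  {a | ∀ a', mdp.Q π s a' ≤ mdp.Q π s a}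

/-- The gap `Δ^π(s) = max_a Q^π(s, a) - max_{a ∉ A^π_s} Q^π(s, a)`, where the second maximum is
`-∞` (and so the gap is `+∞`) if every action maximizes `Q^π(s, ·)`. -/
noncomputable def qGap (mdp : DiscountedMDP S A) (π : Policy S A) (s : S) : EReal :=
  (⨆ a : A, (mdp.Q π s a : EReal)) -
    (⨆ a : A, ⨆ _ : a ∉ mdp.greedyActions π s, (mdp.Q π s a : EReal))

/-- `π 0, π 1, …` are the iterates of natural policy gradient with the step sizes `η 0, η 1, …`,
started from the uniform policy, where the step sizes obey the adaptive rule with parameters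
`L 0, L 1, …`.  A state with gap `+∞` only asks for `0 ≤ η k`, since `x / ⊤ = 0`. -/
structure IsAdaptiveNPG (mdp : DiscountedMDP S A) (L : ℕ → ℝ) (η : ℕ → ℝ)
    (π : ℕ → Policy S A) : Prop where
  init : ∀ s a, π 0 s a = 1 / (Fintype.card A : ℝ)
  update : ∀ k s a, π (k + 1) s a =
    π k s a * Real.exp (η k * mdp.Q (π k) s a) /
      ∑ a', π k s a' * Real.exp (η k * mdp.Q (π k) s a')
  stepSize : ∀ k s, ∀ a ∈ mdp.greedyActions (π k) s,
    ((L k + Real.log ((Fintype.card A : ℝ) / π k s a) : ℝ) : EReal) / mdp.qGap (π k) s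
      ≤ (η k : EReal)

end Trajectories

/-- The state transition matrix `P_π`. -/
noncomputable def transMatrix (mdp : DiscountedMDP S A) (π : Policy S A) : Matrix S S ℝ :=
  Matrix.of fun s s' => ∑ a, mdp.trans s a s' * π s a

/-- The matrix `T_π = γ P_π - I`. -/
noncomputable def T [DecidableEq S] (mdp : DiscountedMDP S A) (π : Policy S A) : Matrix S S ℝ :=
  mdp.discount • mdp.transMatrix π - 1

end DiscountedMDP

/-- The weighted `L¹`-norm `‖v‖_ρ = ∑ ρ(s) |v(s)|`. -/
noncomputable def weightedNorm {S : Type*} [Fintype S] (ρ : stdSimplex ℝ S) (v : S → ℝ) : ℝ :=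
  ∑ s, ρ s * |v s|

/-- The induced norm `‖T‖_ρ = sup {‖T v‖_ρ : ‖v‖_ρ ≤ 1}` of a matrix.  If `ρ` has zero weights,
the supremum can be infinite, so it is taken in `[0, ∞]`. -/
noncomputable def inducedNorm {S : Type*} [Fintype S] (ρ : stdSimplex ℝ S)
    (T : Matrix S S ℝ) : ENNReal :=
  ⨆ v : S → ℝ, ⨆ _ : weightedNorm ρ v ≤ 1, ENNReal.ofReal (weightedNorm ρ (T.mulVec v))

/-- The errors `r k` converge to zero super-linearly with order (at least) `p`: they are dominated
by a positive sequence `ε` that tends to zero with `ε (k + 1) ≤ μ * ε k ^ p` for a constant `μ`. -/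
def ConvergesSuperlinearly (p : ℝ) (r : ℕ → ℝ) : Prop :=
  ∃ (ε : ℕ → ℝ) (μ : ℝ), (∀ k, 0 < ε k) ∧ Filter.Tendsto ε Filter.atTop (nhds 0) ∧
    (∀ k, ε (k + 1) ≤ μ * ε k ^ p) ∧ ∀ k, |r k| ≤ ε k

/-- The exponent `log b / (p - 1) + p log p / (p - 1)²`. -/
noncomputable def rateExponent (b p : ℝ) : ℝ :=
  Real.log b / (p - 1) + p * Real.log p / (p - 1) ^ 2

/-!
Write `V_k` for the value function of `π k`, `V_*` for that of the optimal policy, and `P_k`, `T_k`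
for the matrices `P_π`, `T_π` with `π = π k`; let `d_k = V_*(ρ) - V_k(ρ)`.  The proof views adaptive
natural policy gradient as a perturbed policy iteration, that is, as a perturbed Newton method for
the Bellman equation.

The value functions are integrals over infinite trajectories.  The law of `(S_t, A_t, R_t)` arises
from the initial law by `t` steps of the transition kernel (`map_eval_trajectoryLaw`), and summing
the expected rewards gives the Bellman equations `Q_eq` and `V_eq_sum_Q`.  From there on everything
is linear algebra on `S → ℝ`, governed by the minimum principle `nonneg_of_discount_mulVec_le`: the
matrix `I - γ P_π = -T_π` has a nonnegative inverse.

*One step.*  The step size rule makes `π (k + 1)` give every non-greedy action at most the fraction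
`x_k = exp (-L_k) / 2` of its probability under `π k` (`succ_le_mul`).  So the Bellman residual that
`π (k + 1)` misses is at most the fraction `x_k` of the residual of `V_k`.  This *relative* bound
matters: the minimum principle turns it into the pointwise estimate `V_sub_V_succ_le`,
`V_* - V_{k+1} ≤ (1 - x_k) u + x_k (V_* - V_k)` with `u = T_{k+1}⁻¹ (T_{k+1} - T_*) (V_* - V_k)`;
for `x_k = 0` this is the Newton estimate for exact policy iteration.  Averaging over `ρ`, the two
norm bounds and the monotonicity of `d` give (`avgV_error_succ_le`)
`d_{k+1} ≤ (1 - x_k) b d_k ^ p + x_k d_k`.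
The optimal policy only maximizes an average, but it is optimal in each state of positive weight
(`IsOptimal.mul_V_le`, by switching between two policies), so `d_k` is the weighted norm of
`V_* - V_k`.

*The recursion.*  Let `q ≥ exp (-L)` with `q ≤ 1`, so that `x_k ≤ q ^ p ^ k / 2`.  If
`2 b ≤ D ^ (p - 1)` and `D d_0 ≤ q`, then `D d_k ≤ q ^ p ^ k` for all `k`
(`mul_le_rpow_pow_of_recursion`).  As `p log p ≥ p - 1`, the numbers `D = exp κ` and `D = exp κ⁺`
qualify.  Take `q = max (D d_0) (exp (-L))`, which is less than one if `D d_0 < 1`.  Then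
`D = exp κ⁺` gives the explicit bound (which is trivial by monotonicity if `D d_0 ≥ 1`), and
`D = exp κ` the superlinear convergence.
-/

/-! ### Bellman equations for the trajectory law -/

section SimplexMeasure

variable {ι β : Type*} [Fintype ι] [MeasurableSpace ι] [MeasurableSingletonClass ι]
  [MeasurableSpace β]

lemma simplexMeasure_bind (w : stdSimplex ℝ ι) (κ : ι → Measure β) :
    (simplexMeasure w).bind κ = ∑ i, ENNReal.ofReal (w i) • κ i := by
  ext s hs
  rw [Measure.bind_apply hs (measurable_of_countable _).aemeasurable, simplexMeasure,
    lintegral_finsetSum_measure]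
  simp [Measure.finsetSum_apply]

lemma integral_simplexMeasure_bind (w : stdSimplex ℝ ι) (κ : ι → Measure β) {f : β → ℝ}
    (hf : ∀ i, Integrable f (κ i)) :
    ∫ x, f x ∂((simplexMeasure w).bind κ) = ∑ i, w i * ∫ x, f x ∂(κ i) := by
  rw [simplexMeasure_bind, integral_finsetSum_measure]
  · refine Finset.sum_congr rfl fun i _ => ?_
    have hw : 0 ≤ w i := w.2.1 i
    rw [integral_smul_measure, ENNReal.toReal_ofReal hw, smul_eq_mul]
  · exact fun i _ => (hf i).smul_measure ENNReal.ofReal_ne_top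

end SimplexMeasure

namespace DiscountedMDP

lemma measurable_reward {S A : Type*} [MeasurableSpace S] [MeasurableSpace A] :
    Measurable (fun x : S × A × unitInterval => (x.2.2 : ℝ)) :=
  measurable_subtype_coe.comp (measurable_snd.comp measurable_snd)

lemma integrable_reward {S A : Type*} [MeasurableSpace S] [MeasurableSpace A]
    (μ : Measure (S × A × unitInterval)) [IsProbabilityMeasure μ] :
    Integrable (fun x : S × A × unitInterval => (x.2.2 : ℝ)) μ := by
  refine Integrable.of_bound measurable_reward.aestronglyMeasurable 1 (ae_of_all _ fun x => ?_)
  rw [Real.norm_of_nonneg x.2.2.2.1]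
  exact x.2.2.2.2

variable {S A : Type*} [Fintype S] [Fintype A] [MeasurableSpace S] [MeasurableSpace A]
  [MeasurableSingletonClass S] [MeasurableSingletonClass A]

/-- The law of `(S_t, A_t, R_t)` under the policy `π`, when `(S_0, A_0, R_0)` has law `μ₀`. -/
noncomputable def lawAt (mdp : DiscountedMDP S A) (π : Policy S A) (t : ℕ)
    (μ₀ : Measure (S × A × unitInterval)) : Measure (S × A × unitInterval) :=
  (fun μ => μ.bind (mdp.stepKernel π))^[t] μ₀

instance lawAt_isProbabilityMeasure (mdp : DiscountedMDP S A) (π : Policy S A) (t : ℕ)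
    (μ₀ : Measure (S × A × unitInterval)) [IsProbabilityMeasure μ₀] :
    IsProbabilityMeasure (mdp.lawAt π t μ₀) := by
  induction t with
  | zero => simpa [lawAt]
  | succ t ih =>
    rw [lawAt, Function.iterate_succ_apply']
    rw [lawAt] at ih
    infer_instance

/-- The process `(S_t, A_t, R_t)` is a Markov chain, so its law at time `t` is obtained by iterating
the one-step kernel on the initial law. -/
lemma map_eval_trajectoryLaw (mdp : DiscountedMDP S A) (π : Policy S A) (t : ℕ)
    (μ₀ : Measure (S × A × unitInterval)) [IsProbabilityMeasure μ₀] :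
    (mdp.trajectoryLaw π μ₀).map (fun ω => ω t) = mdp.lawAt π t μ₀ := by
  induction t with
  | zero =>
    have hf : (fun ω : ℕ → S × A × unitInterval => ω 0) =
        (fun h : (i : Finset.Iic 0) → S × A × unitInterval => h ⟨0, Finset.mem_Iic.2 le_rfl⟩) ∘
          Preorder.frestrictLe (π := fun _ => S × A × unitInterval) 0 := rfl
    simp only [lawAt, Function.iterate_zero, id_eq]
    rw [trajectoryLaw, Kernel.trajMeasure, hf, Measure.map_comp _ _ (by fun_prop),
      Kernel.map_comp_right _ (Preorder.measurable_frestrictLe 0) (by fun_prop),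
      Kernel.traj_map_frestrictLe, Kernel.partialTraj_self,
      ← Measure.map_comp _ _ (by fun_prop), Measure.id_comp,
      Measure.map_map (by fun_prop) (by fun_prop)]
    exact Measure.map_id
  | succ t ih =>
    rw [lawAt, Function.iterate_succ_apply', ← lawAt, ← ih]
    have key := congrArg (Measure.map Prod.snd)
      (Kernel.map_frestrictLe_trajMeasure_compProd_eq_map_trajMeasure
        (X := fun _ => S × A × unitInterval) (μ₀ := μ₀) (a := t)
        (κ := fun n => (mdp.stepKernel π).comap
          (fun h : (i : Finset.Iic n) → S × A × unitInterval => h ⟨n, Finset.mem_Iic.2 le_rfl⟩)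
          (by fun_prop)))
    rw [Measure.map_map measurable_snd (by fun_prop)] at key
    refine key.symm.trans ?_
    change Measure.snd _ = _
    rw [Measure.snd_compProd]
    ext u hu
    rw [Measure.bind_apply hu (Kernel.aemeasurable _),
      Measure.bind_apply hu (Kernel.aemeasurable _),
      lintegral_map (Kernel.measurable_coe _ hu) (by fun_prop),
      lintegral_map (Kernel.measurable_coe _ hu) (by fun_prop)]
    rfl

lemma lawAt_succ (mdp : DiscountedMDP S A) (π : Policy S A) (t : ℕ) (s : S) (a : A) :
    mdp.lawAt π (t + 1) (mdp.lawOfStateAction s a) = mdp.lawAt π t (mdp.nextLaw π s a) := by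
  rw [lawAt, Function.iterate_succ_apply, lawAt]
  congr 1
  ext u hu
  rw [Measure.bind_apply hu (Kernel.aemeasurable _), lawOfStateAction,
    lintegral_map (Kernel.measurable_coe _ hu) (by fun_prop)]
  simp only [stepKernel, Kernel.comap_apply, lintegral_const, measure_univ, mul_one]
  rfl

lemma lawAt_bind {ι : Type*} [Countable ι] [MeasurableSpace ι] [MeasurableSingletonClass ι]
    (mdp : DiscountedMDP S A) (π : Policy S A) (t : ℕ)
    (m : Measure ι) (κ : ι → Measure (S × A × unitInterval)) :
    mdp.lawAt π t (m.bind κ) = m.bind (fun i => mdp.lawAt π t (κ i)) := by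
  induction t with
  | zero => simp [lawAt]
  | succ t ih =>
    simp only [lawAt, Function.iterate_succ_apply'] at ih ⊢
    rw [ih, Measure.bind_bind (measurable_of_countable _).aemeasurable (Kernel.aemeasurable _)]

/-- The expected reward at time `t`, when `(S_0, A_0, R_0)` has law `μ₀`. -/
noncomputable def meanRewardAt (mdp : DiscountedMDP S A) (π : Policy S A) (t : ℕ)
    (μ₀ : Measure (S × A × unitInterval)) : ℝ :=
  ∫ x, (x.2.2 : ℝ) ∂(mdp.lawAt π t μ₀)

lemma meanRewardAt_mem_Icc (mdp : DiscountedMDP S A) (π : Policy S A) (t : ℕ)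
    (μ₀ : Measure (S × A × unitInterval)) [IsProbabilityMeasure μ₀] :
    mdp.meanRewardAt π t μ₀ ∈ Set.Icc (0 : ℝ) 1 := by
  refine ⟨integral_nonneg fun x => x.2.2.2.1, ?_⟩
  have := integral_mono (integrable_reward (mdp.lawAt π t μ₀)) (integrable_const (1 : ℝ))
    (fun x => x.2.2.2.2)
  simpa [meanRewardAt] using this

lemma summable_meanRewardAt (mdp : DiscountedMDP S A) (π : Policy S A)
    (μ₀ : Measure (S × A × unitInterval)) [IsProbabilityMeasure μ₀] :
    Summable (fun t => mdp.discount ^ t * mdp.meanRewardAt π t μ₀) := by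
  refine Summable.of_nonneg_of_le
    (fun t => mul_nonneg (pow_nonneg mdp.discount_pos.le _) (mdp.meanRewardAt_mem_Icc π t μ₀).1)
    (fun t => ?_) (summable_geometric_of_lt_one mdp.discount_pos.le mdp.discount_lt_one)
  exact mul_le_of_le_one_right (pow_nonneg mdp.discount_pos.le _)
    (mdp.meanRewardAt_mem_Icc π t μ₀).2

lemma integral_discountedReturn (mdp : DiscountedMDP S A) (π : Policy S A)
    (μ₀ : Measure (S × A × unitInterval)) [IsProbabilityMeasure μ₀] :
    ∫ ω, mdp.discountedReturn ω ∂(mdp.trajectoryLaw π μ₀) =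
      ∑' t, mdp.discount ^ t * mdp.meanRewardAt π t μ₀ := by
  have hP : IsProbabilityMeasure (mdp.trajectoryLaw π μ₀) := by
    unfold trajectoryLaw; infer_instance
  have h1 : ∀ t, ∫ ω, ((ω t).2.2 : ℝ) ∂(mdp.trajectoryLaw π μ₀) = mdp.meanRewardAt π t μ₀ := by
    intro t
    rw [meanRewardAt, ← map_eval_trajectoryLaw, integral_map (measurable_pi_apply t).aemeasurable
      measurable_reward.aestronglyMeasurable]
  have hn : ∀ t (ω : ℕ → S × A × unitInterval),
      ‖mdp.discount ^ t * ((ω t).2.2 : ℝ)‖ = mdp.discount ^ t * ((ω t).2.2 : ℝ) := fun t ω =>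
    Real.norm_of_nonneg (mul_nonneg (pow_nonneg mdp.discount_pos.le _) (ω t).2.2.2.1)
  unfold discountedReturn
  rw [← integral_tsum_of_summable_integral_norm]
  · simp_rw [integral_const_mul, h1]
  · intro t
    refine Integrable.const_mul (Integrable.of_bound
      (measurable_reward.comp (measurable_pi_apply t)).aestronglyMeasurable 1
      (ae_of_all _ fun ω => ?_)) _
    rw [Function.comp_apply, Real.norm_of_nonneg (ω t).2.2.2.1]
    exact (ω t).2.2.2.2
  · simp_rw [hn, integral_const_mul, h1]
    exact mdp.summable_meanRewardAt π μ₀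

lemma meanRewardAt_bind {ι : Type*} [Fintype ι] [MeasurableSpace ι] [MeasurableSingletonClass ι]
    (mdp : DiscountedMDP S A) (π : Policy S A) (t : ℕ) (w : stdSimplex ℝ ι)
    (κ : ι → Measure (S × A × unitInterval)) [∀ i, IsProbabilityMeasure (κ i)] :
    mdp.meanRewardAt π t ((simplexMeasure w).bind κ) = ∑ i, w i * mdp.meanRewardAt π t (κ i) := by
  rw [meanRewardAt, lawAt_bind, integral_simplexMeasure_bind _ _ fun i => integrable_reward _]
  rfl

lemma V_eq_sum_Q (mdp : DiscountedMDP S A) (π : Policy S A) (s : S) :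
    mdp.V π s = ∑ a, π s a * mdp.Q π s a := by
  simp only [V, Q, integral_discountedReturn]
  simp only [lawOfState, meanRewardAt_bind, Finset.mul_sum]
  rw [Summable.tsum_finsetSum]
  · refine Finset.sum_congr rfl fun a _ => ?_
    rw [← tsum_mul_left]
    exact tsum_congr fun t => by ring
  · intro a _
    exact ((mdp.summable_meanRewardAt π (mdp.lawOfStateAction s a)).mul_left (π s a)).congr
      fun t => by ring

/-- The mean of the random reward `R(s, a)`. -/
noncomputable def meanReward (mdp : DiscountedMDP S A) (s : S) (a : A) : ℝ :=
  ∫ r, (r : ℝ) ∂(mdp.reward s a : Measure unitInterval)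

/-- The Bellman equation for the state-action value function. -/
lemma Q_eq (mdp : DiscountedMDP S A) (π : Policy S A) (s : S) (a : A) :
    mdp.Q π s a = mdp.meanReward s a + mdp.discount * ∑ s', mdp.trans s a s' * mdp.V π s' := by
  have h0 : mdp.meanRewardAt π 0 (mdp.lawOfStateAction s a) = mdp.meanReward s a := by
    simp only [meanRewardAt, lawAt, Function.iterate_zero, id_eq, lawOfStateAction, meanReward]
    rw [integral_map (by fun_prop) measurable_reward.aestronglyMeasurable]
  have h1 : ∀ t, mdp.meanRewardAt π (t + 1) (mdp.lawOfStateAction s a) =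
      ∑ s', mdp.trans s a s' * mdp.meanRewardAt π t (mdp.lawOfState π s') := fun t => by
    rw [meanRewardAt, lawAt_succ, nextLaw, ← meanRewardAt, meanRewardAt_bind]
  rw [Q, integral_discountedReturn, (mdp.summable_meanRewardAt π _).tsum_eq_zero_add, h0]
  simp only [V, integral_discountedReturn, h1, pow_zero, one_mul, Finset.mul_sum]
  congr 1
  rw [Summable.tsum_finsetSum]
  · refine Finset.sum_congr rfl fun s' _ => ?_
    rw [← tsum_mul_left, ← tsum_mul_left]
    exact tsum_congr fun t => by ring
  · intro s' _
    exact ((mdp.summable_meanRewardAt π (mdp.lawOfState π s')).mul_left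
      (mdp.discount * mdp.trans s a s')).congr fun t => by ring

end DiscountedMDP

/-! ### Weighted norms -/

section WeightedNorm

variable {S : Type*} [Fintype S]

lemma weightedNorm_nonneg (ρ : stdSimplex ℝ S) (v : S → ℝ) : 0 ≤ weightedNorm ρ v :=
  Finset.sum_nonneg fun s _ => mul_nonneg (ρ.2.1 s) (abs_nonneg _)

lemma weightedNorm_smul (ρ : stdSimplex ℝ S) (c : ℝ) (v : S → ℝ) :
    weightedNorm ρ (c • v) = |c| * weightedNorm ρ v := by
  simp only [weightedNorm, Pi.smul_apply, smul_eq_mul, abs_mul, Finset.mul_sum]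
  exact Finset.sum_congr rfl fun s _ => by ring

lemma weightedNorm_neg (ρ : stdSimplex ℝ S) (v : S → ℝ) :
    weightedNorm ρ (-v) = weightedNorm ρ v := by
  simp [weightedNorm]

lemma sum_le_weightedNorm (ρ : stdSimplex ℝ S) (v : S → ℝ) :
    ∑ s, ρ s * v s ≤ weightedNorm ρ v :=
  Finset.sum_le_sum fun s _ => mul_le_mul_of_nonneg_left (le_abs_self _) (ρ.2.1 s)

/-- A finite induced norm bounds the matrix on all vectors, including those of weighted norm zero
(which exist if `ρ` has zero weights). -/
lemma weightedNorm_mulVec_le (ρ : stdSimplex ℝ S) {T : Matrix S S ℝ} {c : ℝ} (hc : 0 ≤ c)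
    (hT : inducedNorm ρ T ≤ ENNReal.ofReal c) (v : S → ℝ) :
    weightedNorm ρ (T.mulVec v) ≤ c * weightedNorm ρ v := by
  have h1 : ∀ w : S → ℝ, weightedNorm ρ w ≤ 1 → weightedNorm ρ (T.mulVec w) ≤ c := by
    intro w hw
    rw [← ENNReal.ofReal_le_ofReal_iff hc]
    exact (le_iSup₂ (f := fun (v : S → ℝ) (_ : weightedNorm ρ v ≤ 1) =>
      ENNReal.ofReal (weightedNorm ρ (T.mulVec v))) w hw).trans hT
  have h2 : ∀ r : ℝ, 0 < r → r * weightedNorm ρ v ≤ 1 → r * weightedNorm ρ (T.mulVec v) ≤ c := by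
    intro r hr hrv
    have := h1 (r • v) (by rwa [weightedNorm_smul, abs_of_pos hr])
    rwa [Matrix.mulVec_smul, weightedNorm_smul, abs_of_pos hr] at this
  rcases (weightedNorm_nonneg ρ v).eq_or_lt with h | h
  · rw [← h, mul_zero]
    -- Every multiple of `v` has norm at most one, so `T v` must have norm zero.
    by_contra! hpos
    have := h2 ((c + 1) / weightedNorm ρ (T.mulVec v)) (by positivity) (by rw [← h]; simp)
    rw [div_mul_cancel₀ _ hpos.ne'] at this
    linarith
  · have := h2 (weightedNorm ρ v)⁻¹ (by positivity) (inv_mul_cancel₀ h.ne').le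
    rwa [inv_mul_le_iff₀ h, mul_comm] at this

end WeightedNorm

namespace DiscountedMDP

/-! ### The Bellman operator of a policy -/

section Transition

variable {S A : Type*} [Fintype S] [Fintype A]

lemma transMatrix_nonneg (mdp : DiscountedMDP S A) (π : Policy S A) (s s' : S) :
    0 ≤ mdp.transMatrix π s s' :=
  Finset.sum_nonneg fun a _ => mul_nonneg ((mdp.trans s a).2.1 s') ((π s).2.1 a)

lemma transMatrix_row_sum (mdp : DiscountedMDP S A) (π : Policy S A) (s : S) :
    ∑ s', mdp.transMatrix π s s' = 1 := by
  have h : ∀ a, ∑ s', mdp.trans s a s' = 1 := fun a => (mdp.trans s a).2.2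
  simp only [transMatrix, Matrix.of_apply]
  rw [Finset.sum_comm]
  simp only [← Finset.sum_mul, h, one_mul]
  exact (π s).2.2

/-- The minimum principle: `I - γ P_π` has a nonnegative inverse. -/
lemma nonneg_of_discount_mulVec_le (mdp : DiscountedMDP S A) (π : Policy S A) {w : S → ℝ}
    (hw : ∀ s, mdp.discount * (mdp.transMatrix π).mulVec w s ≤ w s) (s : S) : 0 ≤ w s := by
  -- At a state `s₀` where `w` is minimal, `γ w s₀ ≤ γ (P w) s₀ ≤ w s₀`.
  obtain ⟨s₀, -, hs₀⟩ := Finset.exists_min_image Finset.univ w ⟨s, Finset.mem_univ s⟩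
  have h1 : w s₀ ≤ (mdp.transMatrix π).mulVec w s₀ := by
    calc w s₀ = ∑ s', mdp.transMatrix π s₀ s' * w s₀ := by
          rw [← Finset.sum_mul, transMatrix_row_sum, one_mul]
      _ ≤ _ := Finset.sum_le_sum fun s' _ =>
          mul_le_mul_of_nonneg_left (hs₀ s' (Finset.mem_univ _)) (mdp.transMatrix_nonneg π _ _)
  have h2 := hw s₀
  have h3 := mdp.discount_pos
  have h4 := mdp.discount_lt_one
  have h5 : 0 ≤ w s₀ := by nlinarith
  exact h5.trans (hs₀ s (Finset.mem_univ s))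

lemma T_mulVec [DecidableEq S] (mdp : DiscountedMDP S A) (π : Policy S A) (w : S → ℝ) (s : S) :
    (mdp.T π).mulVec w s = mdp.discount * (mdp.transMatrix π).mulVec w s - w s := by
  simp [T, Matrix.sub_mulVec, Matrix.smul_mulVec]

lemma isUnit_det_T [DecidableEq S] (mdp : DiscountedMDP S A) (π : Policy S A) :
    IsUnit (mdp.T π).det := by
  rw [← Matrix.isUnit_iff_isUnit_det, ← Matrix.mulVec_injective_iff_isUnit]
  have key : ∀ w, (mdp.T π).mulVec w = 0 → ∀ s, 0 ≤ w s := fun w hw =>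
    mdp.nonneg_of_discount_mulVec_le π fun s => by
      have := congrFun hw s
      rw [T_mulVec, Pi.zero_apply] at this
      linarith
  refine (injective_iff_map_eq_zero (Matrix.mulVecLin (mdp.T π))).2 fun w hw => ?_
  rw [Matrix.mulVecLin_apply] at hw
  funext s
  have h2 := key (-w) (by rw [Matrix.mulVec_neg, hw, neg_zero]) s
  rw [Pi.neg_apply] at h2
  exact le_antisymm (by simpa using h2) (key w hw s)

end Transition

variable {S A : Type*} [Fintype S] [Fintype A]

/-- The value of the action `a` in the state `s`, if the value function from the next step on
is `v`. -/
noncomputable def actionValue (mdp : DiscountedMDP S A) (v : S → ℝ) (s : S) (a : A) : ℝ :=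
  mdp.meanReward s a + mdp.discount * ∑ s', mdp.trans s a s' * v s'

/-- The Bellman operator of the policy `π`. -/
noncomputable def bellman (mdp : DiscountedMDP S A) (π : Policy S A) (v : S → ℝ) (s : S) : ℝ :=
  ∑ a, π s a * mdp.actionValue v s a

lemma bellman_sub (mdp : DiscountedMDP S A) (π : Policy S A) (v w : S → ℝ) (s : S) :
    mdp.bellman π v s - mdp.bellman π w s =
      mdp.discount * (mdp.transMatrix π).mulVec (v - w) s := by
  simp only [bellman, actionValue, transMatrix, Matrix.mulVec, dotProduct, Matrix.of_apply,
    Pi.sub_apply, Finset.sum_mul]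
  rw [Finset.sum_comm, Finset.mul_sum, ← Finset.sum_sub_distrib]
  refine Finset.sum_congr rfl fun a _ => ?_
  rw [← mul_sub, add_sub_add_left_eq_sub, ← mul_sub, ← Finset.sum_sub_distrib, Finset.mul_sum,
    Finset.mul_sum, Finset.mul_sum]
  exact Finset.sum_congr rfl fun s' _ => by ring

lemma bellman_mono (mdp : DiscountedMDP S A) (π : Policy S A) {v w : S → ℝ}
    (h : ∀ s, v s ≤ w s) (s : S) : mdp.bellman π v s ≤ mdp.bellman π w s := by
  have : 0 ≤ mdp.discount * (mdp.transMatrix π).mulVec (w - v) s :=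
    mul_nonneg mdp.discount_pos.le (Finset.sum_nonneg fun s' _ =>
      mul_nonneg (mdp.transMatrix_nonneg π _ _) (sub_nonneg.2 (h s')))
  rw [← bellman_sub] at this
  linarith

lemma bellman_congr (mdp : DiscountedMDP S A) {π π' : Policy S A} {s : S} (h : π s = π' s)
    (v : S → ℝ) : mdp.bellman π v s = mdp.bellman π' v s := by
  simp only [bellman, h]

variable [MeasurableSpace S] [MeasurableSpace A]
  [MeasurableSingletonClass S] [MeasurableSingletonClass A]

lemma Q_eq_actionValue (mdp : DiscountedMDP S A) (π : Policy S A) (s : S) (a : A) :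
    mdp.Q π s a = mdp.actionValue (mdp.V π) s a :=
  mdp.Q_eq π s a

/-- The value function is the fixed point of the Bellman operator. -/
lemma bellman_V (mdp : DiscountedMDP S A) (π : Policy S A) (s : S) :
    mdp.bellman π (mdp.V π) s = mdp.V π s := by
  simp only [bellman, ← Q_eq_actionValue]
  exact (mdp.V_eq_sum_Q π s).symm

lemma le_V_of_le_bellman (mdp : DiscountedMDP S A) (π : Policy S A) {v : S → ℝ}
    (h : ∀ s, v s ≤ mdp.bellman π v s) (s : S) : v s ≤ mdp.V π s := by
  refine sub_nonneg.1 (mdp.nonneg_of_discount_mulVec_le π (w := mdp.V π - v) (fun s => ?_) s)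
  rw [← bellman_sub, bellman_V, Pi.sub_apply]
  linarith [h s]

/-- A policy that maximizes the average value for the initial distribution `ρ` is optimal in every
state of positive weight; the factor `ρ s` discards the other states. -/
lemma IsOptimal.mul_V_le {mdp : DiscountedMDP S A} {ρ : stdSimplex ℝ S} {πstar : Policy S A}
    (h : mdp.IsOptimal ρ πstar) (π : Policy S A) (s : S) :
    ρ s * mdp.V π s ≤ ρ s * mdp.V πstar s := by
  classical
  -- In each state, `π'` follows the better one of the two policies.
  let π' : Policy S A := fun s => if mdp.V π s ≤ mdp.V πstar s then πstar s else π s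
  let W : S → ℝ := fun s => max (mdp.V πstar s) (mdp.V π s)
  have hW : ∀ s, W s ≤ mdp.V π' s := mdp.le_V_of_le_bellman π' fun s => by
    by_cases hs : mdp.V π s ≤ mdp.V πstar s
    · rw [mdp.bellman_congr (π' := πstar) (by simp [π', hs])]
      calc W s = mdp.V πstar s := max_eq_left hs
        _ = mdp.bellman πstar (mdp.V πstar) s := (mdp.bellman_V πstar s).symm
        _ ≤ _ := mdp.bellman_mono πstar (fun s => le_max_left _ _) s
    · rw [mdp.bellman_congr (π' := π) (by simp [π', hs])]
      calc W s = mdp.V π s := max_eq_right (not_le.1 hs).le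
        _ = mdp.bellman π (mdp.V π) s := (mdp.bellman_V π s).symm
        _ ≤ _ := mdp.bellman_mono π (fun s => le_max_right _ _) s
  have h1 : ∀ s ∈ Finset.univ, ρ s * mdp.V πstar s ≤ ρ s * mdp.V π' s := fun s _ =>
    mul_le_mul_of_nonneg_left ((le_max_left _ _).trans (hW s)) (ρ.2.1 s)
  have h2 := (Finset.sum_eq_sum_iff_of_le h1).1
    (le_antisymm (Finset.sum_le_sum h1) (h π')) s (Finset.mem_univ s)
  rw [h2]
  exact mul_le_mul_of_nonneg_left ((le_max_right _ _).trans (hW s)) (ρ.2.1 s)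

lemma IsOptimal.weightedNorm_sub {mdp : DiscountedMDP S A} {ρ : stdSimplex ℝ S}
    {πstar : Policy S A} (h : mdp.IsOptimal ρ πstar) (π : Policy S A) :
    weightedNorm ρ (mdp.V π - mdp.V πstar) = mdp.avgV ρ πstar - mdp.avgV ρ π := by
  rw [weightedNorm, avgV, avgV, ← Finset.sum_sub_distrib]
  refine Finset.sum_congr rfl fun s _ => ?_
  have hρ : 0 ≤ ρ s := ρ.2.1 s
  have h1 := h.mul_V_le π s
  calc ρ s * |mdp.V π s - mdp.V πstar s| = |ρ s * (mdp.V π s - mdp.V πstar s)| := by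
        rw [abs_mul, abs_of_nonneg hρ]
    _ = _ := by rw [abs_of_nonpos (by linarith)]; ring

end DiscountedMDP

namespace DiscountedMDP

variable {S A : Type*} [Fintype S] [Fintype A] [MeasurableSpace S] [MeasurableSpace A]
  [MeasurableSingletonClass S] [MeasurableSingletonClass A]

/-! ### One step of adaptive natural policy gradient -/

lemma exists_mem_greedyActions (mdp : DiscountedMDP S A) (π : Policy S A) (s : S) :
    ∃ a, a ∈ mdp.greedyActions π s := by
  have : Nonempty A := by
    by_contra h
    have := not_nonempty_iff.1 h
    have h1 : ∑ a, π s a = 1 := (π s).2.2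
    simp at h1
  obtain ⟨a, ha⟩ := Finite.exists_max (mdp.Q π s)
  exact ⟨a, ha⟩

/-- If some action is not greedy, the gap is finite, and it is the distance from the greedy value
to the value of a best action `b` among the others. -/
lemma exists_qGap_eq (mdp : DiscountedMDP S A) (π : Policy S A) {s : S} {a' a : A}
    (ha' : a' ∈ mdp.greedyActions π s) (ha : a ∉ mdp.greedyActions π s) :
    ∃ b, b ∉ mdp.greedyActions π s ∧ mdp.Q π s a ≤ mdp.Q π s b ∧
      mdp.qGap π s = ((mdp.Q π s a' - mdp.Q π s b : ℝ) : EReal) := by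
  obtain ⟨b, hb, hmax⟩ := Set.exists_max_image {c | c ∉ mdp.greedyActions π s} (mdp.Q π s)
    (Set.toFinite _) ⟨a, ha⟩
  refine ⟨b, hb, hmax a ha, ?_⟩
  have h1 : (⨆ c : A, (mdp.Q π s c : EReal)) = mdp.Q π s a' :=
    le_antisymm (iSup_le fun c => EReal.coe_le_coe_iff.2 (ha' c))
      (le_iSup (fun c => (mdp.Q π s c : EReal)) a')
  have h2 : (⨆ c : A, ⨆ _ : c ∉ mdp.greedyActions π s, (mdp.Q π s c : EReal)) = mdp.Q π s b :=
    le_antisymm (iSup₂_le fun c hc => EReal.coe_le_coe_iff.2 (hmax c hc))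
      (le_iSup₂ (f := fun c (_ : c ∉ mdp.greedyActions π s) => (mdp.Q π s c : EReal)) b hb)
  rw [qGap, h1, h2, EReal.coe_sub]

lemma Q_lt_of_notMem_greedyActions (mdp : DiscountedMDP S A) (π : Policy S A) {s : S} {a' a : A}
    (ha' : a' ∈ mdp.greedyActions π s) (ha : a ∉ mdp.greedyActions π s) :
    mdp.Q π s a < mdp.Q π s a' := by
  by_contra! h
  exact ha fun c => (ha' c).trans h

lemma sum_mul_Q_le (mdp : DiscountedMDP S A) (π π' : Policy S A) {s : S} {a' : A}
    (ha' : a' ∈ mdp.greedyActions π s) : ∑ a, π' s a * mdp.Q π s a ≤ mdp.Q π s a' := by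
  have hsum : ∑ a, π' s a = 1 := (π' s).2.2
  calc ∑ a, π' s a * mdp.Q π s a ≤ ∑ a, π' s a * mdp.Q π s a' :=
        Finset.sum_le_sum fun a _ => mul_le_mul_of_nonneg_left (ha' a) ((π' s).2.1 a)
    _ = _ := by rw [← Finset.sum_mul, hsum, one_mul]

namespace IsAdaptiveNPG

variable {mdp : DiscountedMDP S A} {L η : ℕ → ℝ} {π : ℕ → Policy S A}

lemma pos (h : mdp.IsAdaptiveNPG L η π) (k : ℕ) (s : S) (a : A) : 0 < π k s a := by
  have : Nonempty A := ⟨a⟩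
  induction k generalizing a with
  | zero => rw [h.init]; positivity
  | succ k ih =>
    rw [h.update]
    exact div_pos (mul_pos (ih a) (Real.exp_pos _))
      (Finset.sum_pos (fun a' _ => mul_pos (ih a') (Real.exp_pos _)) Finset.univ_nonempty)

lemma le_stepSize_mul (h : mdp.IsAdaptiveNPG L η π) (hL : ∀ k, 0 < L k) (k : ℕ) {s : S} {a' a : A}
    (ha' : a' ∈ mdp.greedyActions (π k) s) (ha : a ∉ mdp.greedyActions (π k) s) :
    L k + Real.log ((Fintype.card A : ℝ) / π k s a') ≤
      η k * (mdp.Q (π k) s a' - mdp.Q (π k) s a) := by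
  obtain ⟨b, hb, hab, hgap⟩ := mdp.exists_qGap_eq (π k) ha' ha
  have hpos := sub_pos.2 (mdp.Q_lt_of_notMem_greedyActions (π k) ha' hb)
  have h1 := h.stepSize k s a' ha'
  rw [hgap, ← EReal.coe_div, EReal.coe_le_coe_iff, div_le_iff₀ hpos] at h1
  have hle : π k s a' ≤ 1 := stdSimplex.le_one (π k s) a'
  have hcard : (1 : ℝ) ≤ Fintype.card A := by
    exact_mod_cast Fintype.card_pos_iff.2 ⟨a⟩
  have hlog : 0 ≤ Real.log ((Fintype.card A : ℝ) / π k s a') :=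
    Real.log_nonneg ((one_le_div (h.pos k s a')).2 (hle.trans hcard))
  have hη : 0 ≤ η k := by
    have := hL k
    by_contra! hneg
    have := mul_neg_of_neg_of_pos hneg hpos
    linarith
  refine h1.trans (mul_le_mul_of_nonneg_left ?_ hη)
  linarith

/-- One step shrinks the probability of every action that is not greedy by the factor
`exp (-L k) / 2`.  The rule for the step size gives the factor `exp (-L k) / |A|`, and there are at
least two actions if one of them is not greedy. -/
lemma succ_le_mul (h : mdp.IsAdaptiveNPG L η π) (hL : ∀ k, 0 < L k) (k : ℕ) {s : S} {a : A}
    (ha : a ∉ mdp.greedyActions (π k) s) :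
    π (k + 1) s a ≤ Real.exp (-L k) / 2 * π k s a := by
  obtain ⟨a', ha'⟩ := mdp.exists_mem_greedyActions (π k) s
  have hne : a ≠ a' := fun h => ha (h ▸ ha')
  have hcard : (2 : ℝ) ≤ Fintype.card A := by
    exact_mod_cast Fintype.one_lt_card_iff.2 ⟨a, a', hne⟩
  have hpa := h.pos k s a
  have hpa' := h.pos k s a'
  have hZ : π k s a' * Real.exp (η k * mdp.Q (π k) s a') ≤
      ∑ c, π k s c * Real.exp (η k * mdp.Q (π k) s c) :=
    Finset.single_le_sum (f := fun c => π k s c * Real.exp (η k * mdp.Q (π k) s c))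
      (fun c _ => (mul_pos (h.pos k s c) (Real.exp_pos _)).le) (Finset.mem_univ a')
  have hexp : Real.exp (L k) * ((Fintype.card A : ℝ) / π k s a') * Real.exp (η k * mdp.Q (π k) s a)
      ≤ Real.exp (η k * mdp.Q (π k) s a') := by
    rw [← Real.exp_log (show 0 < (Fintype.card A : ℝ) / π k s a' by positivity), ← Real.exp_add,
      ← Real.exp_add, Real.exp_le_exp]
    linarith [h.le_stepSize_mul hL k ha' ha]
  have hexp' : Real.exp (L k) * 2 * Real.exp (η k * mdp.Q (π k) s a) ≤
      π k s a' * Real.exp (η k * mdp.Q (π k) s a') := by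
    calc _ ≤ Real.exp (L k) * (Fintype.card A : ℝ) * Real.exp (η k * mdp.Q (π k) s a) := by gcongr
      _ = π k s a' * (Real.exp (L k) * ((Fintype.card A : ℝ) / π k s a') *
          Real.exp (η k * mdp.Q (π k) s a)) := by field_simp
      _ ≤ _ := by gcongr
  rw [h.update, div_le_iff₀ (lt_of_lt_of_le (by positivity) hZ)]
  calc π k s a * Real.exp (η k * mdp.Q (π k) s a)
      = Real.exp (-L k) / 2 * π k s a *
          (Real.exp (L k) * 2 * Real.exp (η k * mdp.Q (π k) s a)) := by
        rw [Real.exp_neg]; field_simp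
    _ ≤ _ := by gcongr; exact hexp'.trans hZ

/-- The policy `π (k + 1)` is almost greedy for `V (π k)`: its loss against the greedy value is at
most the fraction `exp (-L k) / 2` of the loss of `π k`. -/
lemma le_bellman_succ (h : mdp.IsAdaptiveNPG L η π) (hL : ∀ k, 0 < L k) (k : ℕ) {s : S} {a' : A}
    (ha' : a' ∈ mdp.greedyActions (π k) s) :
    (1 - Real.exp (-L k) / 2) * mdp.Q (π k) s a' + Real.exp (-L k) / 2 * mdp.V (π k) s ≤
      mdp.bellman (π (k + 1)) (mdp.V (π k)) s := by
  have loss : ∀ π' : Policy S A, mdp.Q (π k) s a' - mdp.bellman π' (mdp.V (π k)) s =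
      ∑ a, π' s a * (mdp.Q (π k) s a' - mdp.Q (π k) s a) := by
    intro π'
    have h1 : ∑ a, π' s a = 1 := (π' s).2.2
    simp only [mul_sub, Finset.sum_sub_distrib, ← Finset.sum_mul, h1, one_mul, bellman,
      Q_eq_actionValue]
  have key : mdp.Q (π k) s a' - mdp.bellman (π (k + 1)) (mdp.V (π k)) s ≤
      Real.exp (-L k) / 2 * (mdp.Q (π k) s a' - mdp.bellman (π k) (mdp.V (π k)) s) := by
    rw [loss, loss, Finset.mul_sum]
    refine Finset.sum_le_sum fun a _ => ?_
    have hQ : 0 ≤ mdp.Q (π k) s a' - mdp.Q (π k) s a := sub_nonneg.2 (ha' a)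
    rw [← mul_assoc]
    by_cases ha : a ∈ mdp.greedyActions (π k) s
    · rw [le_antisymm (ha' a) (ha a')]
      simp
    · exact mul_le_mul_of_nonneg_right (h.succ_le_mul hL k ha) hQ
  rw [bellman_V] at key
  linarith

lemma V_le_V_succ (h : mdp.IsAdaptiveNPG L η π) (hL : ∀ k, 0 < L k) (k : ℕ) (s : S) :
    mdp.V (π k) s ≤ mdp.V (π (k + 1)) s := by
  refine mdp.le_V_of_le_bellman (π (k + 1)) (fun s => ?_) s
  obtain ⟨a', ha'⟩ := mdp.exists_mem_greedyActions (π k) s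
  have h1 := h.le_bellman_succ hL k ha'
  have h2 : mdp.V (π k) s ≤ mdp.Q (π k) s a' := by
    rw [V_eq_sum_Q]
    exact mdp.sum_mul_Q_le (π k) (π k) ha'
  have h3 : Real.exp (-L k) ≤ 1 := Real.exp_le_one_iff.2 (neg_nonpos.2 (hL k).le)
  nlinarith

lemma avgV_le_avgV_succ (h : mdp.IsAdaptiveNPG L η π) (hL : ∀ k, 0 < L k) (ρ : stdSimplex ℝ S)
    (k : ℕ) : mdp.avgV ρ (π k) ≤ mdp.avgV ρ (π (k + 1)) :=
  Finset.sum_le_sum fun s _ => mul_le_mul_of_nonneg_left (h.V_le_V_succ hL k s) (ρ.2.1 s)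

/-- The pointwise error estimate. If `u` solves the linear equation
`(I - γ P_{k+1}) u = (T_* - T_{k+1}) (V_* - V_k)`, then
`V_* - V_{k+1} ≤ (1 - x) u + x (V_* - V_k)` with `x = exp (-L k) / 2`. -/
lemma V_sub_V_succ_le (h : mdp.IsAdaptiveNPG L η π) (hL : ∀ k, 0 < L k) (k : ℕ)
    (πstar : Policy S A) [DecidableEq S] {u : S → ℝ}
    (hu : (mdp.T (π (k + 1))).mulVec u =
      (mdp.T (π (k + 1)) - mdp.T πstar).mulVec (mdp.V πstar - mdp.V (π k))) (s : S) :
    mdp.V πstar s - mdp.V (π (k + 1)) s ≤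
      (1 - Real.exp (-L k) / 2) * u s +
        Real.exp (-L k) / 2 * (mdp.V πstar s - mdp.V (π k) s) := by
  set x := Real.exp (-L k) / 2 with hx
  have hx1 : x ≤ 1 := by
    have := Real.exp_le_one_iff.2 (neg_nonpos.2 (hL k).le)
    linarith
  -- The function `w`, the right-hand side minus the left-hand side, satisfies
  -- `(I - γ P_{k+1}) w = B_{k+1} V_k - (1 - x) B_* V_k - x V_k` for the Bellman operators `B`.
  refine sub_nonneg.1 (mdp.nonneg_of_discount_mulVec_le (π (k + 1))
    (w := (1 - x) • u + x • (mdp.V πstar - mdp.V (π k)) - (mdp.V πstar - mdp.V (π (k + 1))))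
    (fun s => ?_) s)
  obtain ⟨a', ha'⟩ := mdp.exists_mem_greedyActions (π k) s
  have h1 := h.le_bellman_succ hL k ha'
  rw [← hx] at h1
  have h2 : mdp.bellman πstar (mdp.V (π k)) s ≤ mdp.Q (π k) s a' := by
    simp only [bellman, ← Q_eq_actionValue]
    exact mdp.sum_mul_Q_le (π k) πstar ha'
  have h3 := congrFun hu s
  rw [Matrix.sub_mulVec, Pi.sub_apply, T_mulVec, T_mulVec, T_mulVec] at h3
  have e1 := mdp.bellman_sub πstar (mdp.V πstar) (mdp.V (π k)) s
  have e2 := mdp.bellman_sub (π (k + 1)) (mdp.V (π (k + 1))) (mdp.V (π k)) s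
  rw [bellman_V] at e1 e2
  have h4 := mul_le_mul_of_nonneg_left h2 (sub_nonneg.2 hx1)
  simp only [Matrix.mulVec_sub, Matrix.mulVec_add, Matrix.mulVec_smul, Pi.sub_apply, Pi.add_apply,
    Pi.smul_apply, smul_eq_mul] at h3 e1 e2 ⊢
  linear_combination h1 + h4 + (1 - x) * h3 + (1 - x) * e1 - e2

end IsAdaptiveNPG

end DiscountedMDP

/-! ### The scalar recursion -/

/-- A sequence with `d (k + 1) ≤ (1 - x k) * (b * d k ^ p) + x k * d k` decays like `q ^ p ^ k`,
up to the scaling `D`, once it starts below `q / D`.  Each of the two terms accounts for one half of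
the bound; the second one does so because `p ≤ 2`. -/
lemma mul_le_rpow_pow_of_recursion {d x : ℕ → ℝ} {b p D q : ℝ} (hp1 : 1 < p) (hp2 : p ≤ 2)
    (hd : ∀ k, 0 ≤ d k) (hx : ∀ k, 0 ≤ x k) (hx1 : ∀ k, x k ≤ q ^ p ^ k / 2) (hb : 0 ≤ b)
    (hD : 0 < D) (hbD : b * 2 ≤ D ^ (p - 1)) (hq : 0 < q) (hq1 : q ≤ 1) (h0 : D * d 0 ≤ q)
    (hrec : ∀ k, d (k + 1) ≤ (1 - x k) * (b * d k ^ p) + x k * d k) (k : ℕ) :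
    D * d k ≤ q ^ p ^ k := by
  induction k with
  | zero => simpa using h0
  | succ k ih =>
    have hpk : (0 : ℝ) ≤ p ^ k := by positivity
    have hDd : 0 ≤ D * d k := mul_nonneg hD.le (hd k)
    have hdp : 0 ≤ d k ^ p := Real.rpow_nonneg (hd k) p
    have h1 : D * (b * d k ^ p) ≤ q ^ p ^ (k + 1) / 2 := by
      calc D * (b * d k ^ p) = D * d k ^ p * (b * 2) / 2 := by ring
        _ ≤ D * d k ^ p * D ^ (p - 1) / 2 := by gcongr
        _ = (D * d k) ^ p / 2 := by
          rw [Real.mul_rpow hD.le (hd k), Real.rpow_sub_one hD.ne']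
          field_simp
        _ ≤ (q ^ p ^ k) ^ p / 2 := by gcongr
        _ = _ := by rw [← Real.rpow_mul hq.le, pow_succ]
    have h2 : x k * (D * d k) ≤ q ^ p ^ (k + 1) / 2 := by
      calc x k * (D * d k) ≤ q ^ p ^ k / 2 * q ^ p ^ k := by
            gcongr
            exact hx1 k
        _ = q ^ (2 * p ^ k) / 2 := by rw [two_mul, Real.rpow_add hq]; ring
        _ ≤ _ := by
          refine div_le_div_of_nonneg_right ?_ zero_le_two
          refine Real.rpow_le_rpow_of_exponent_ge hq hq1 ?_
          rw [pow_succ]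
          nlinarith
    calc D * d (k + 1) ≤ D * ((1 - x k) * (b * d k ^ p) + x k * d k) := by
          gcongr
          exact hrec k
      _ = D * (b * d k ^ p) - x k * (D * (b * d k ^ p)) + x k * (D * d k) := by ring
      _ ≤ D * (b * d k ^ p) + x k * (D * d k) := by
        have := mul_nonneg (hx k) (mul_nonneg hD.le (mul_nonneg hb hdp))
        linarith
      _ ≤ _ := by linarith

/-- The scaling `D = exp (rateExponent b p)` absorbs the coefficient `2 * b`, because
`p * log p ≥ p - 1`. -/
lemma mul_two_le_exp_rateExponent {b p : ℝ} (hb : 0 < b) (hp : 1 < p) :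
    b * 2 ≤ Real.exp (rateExponent b p) ^ (p - 1) := by
  have hp0 : 0 < p - 1 := sub_pos.2 hp
  have hlog : 1 ≤ p * Real.log p / (p - 1) := by
    rw [one_le_div hp0]
    have h1 := Real.one_sub_inv_le_log_of_pos (zero_lt_one.trans hp)
    calc p - 1 = p * (1 - p⁻¹) := by field_simp
      _ ≤ _ := by gcongr
  have hk : rateExponent b p * (p - 1) = Real.log b + p * Real.log p / (p - 1) := by
    rw [rateExponent]
    field_simp
  rw [← Real.exp_mul, hk, Real.exp_add, Real.exp_log hb]
  have h2 := Real.add_one_le_exp (1 : ℝ)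
  have h3 := Real.exp_le_exp.2 hlog
  gcongr
  linarith

lemma tendsto_rpow_pow_atTop {p q : ℝ} (hp : 1 < p) (hq : 0 < q) (hq1 : q < 1) :
    Filter.Tendsto (fun k : ℕ => q ^ p ^ k) Filter.atTop (nhds 0) :=
  (tendsto_rpow_atTop_of_base_lt_one q (by linarith) hq1).comp
    (tendsto_pow_atTop_atTop_of_one_lt hp)

/-! ### Superlinear convergence -/

namespace DiscountedMDP

variable {S A : Type*} [Fintype S] [Fintype A] [MeasurableSpace S] [MeasurableSpace A]
  [MeasurableSingletonClass S] [MeasurableSingletonClass A]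

/-- The recursion for the errors of the average values.  The bound on the matrices `T` concerns the
policy `π (k + 1)`, so it involves the new error; this is at most the old one. -/
lemma IsAdaptiveNPG.avgV_error_succ_le [DecidableEq S] {mdp : DiscountedMDP S A} {L η : ℕ → ℝ}
    {π : ℕ → Policy S A} (h : mdp.IsAdaptiveNPG L η π) (hL : ∀ k, 0 < L k)
    {ρ : stdSimplex ℝ S} {πstar : Policy S A} (hstar : mdp.IsOptimal ρ πstar)
    {p : ℝ} (hp1 : 1 < p) {Ltilde M : ℝ} (hLtilde : 0 < Ltilde) (hM : 0 < M) (k : ℕ)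
    (hLip : inducedNorm ρ (mdp.T (π (k + 1)) - mdp.T πstar) ≤
      ENNReal.ofReal (Ltilde * weightedNorm ρ (mdp.V (π (k + 1)) - mdp.V πstar) ^ (p - 1)))
    (hInv : inducedNorm ρ (mdp.T (π (k + 1)))⁻¹ ≤ ENNReal.ofReal M) :
    mdp.avgV ρ πstar - mdp.avgV ρ (π (k + 1)) ≤
      (1 - Real.exp (-L k) / 2) *
          (Ltilde * M * (mdp.avgV ρ πstar - mdp.avgV ρ (π k)) ^ p) +
        Real.exp (-L k) / 2 * (mdp.avgV ρ πstar - mdp.avgV ρ (π k)) := by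
  set u := (mdp.T (π (k + 1)))⁻¹.mulVec
    ((mdp.T (π (k + 1)) - mdp.T πstar).mulVec (mdp.V πstar - mdp.V (π k))) with hu
  have hTu : (mdp.T (π (k + 1))).mulVec u =
      (mdp.T (π (k + 1)) - mdp.T πstar).mulVec (mdp.V πstar - mdp.V (π k)) := by
    rw [hu, Matrix.mulVec_mulVec, Matrix.mul_nonsing_inv _ (mdp.isUnit_det_T _), Matrix.one_mulVec]
  have hx1 : Real.exp (-L k) ≤ 1 := Real.exp_le_one_iff.2 (neg_nonpos.2 (hL k).le)
  have hsum : mdp.avgV ρ πstar - mdp.avgV ρ (π (k + 1)) ≤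
      (1 - Real.exp (-L k) / 2) * ∑ s, ρ s * u s +
        Real.exp (-L k) / 2 * (mdp.avgV ρ πstar - mdp.avgV ρ (π k)) := by
    simp only [avgV, ← Finset.sum_sub_distrib, Finset.mul_sum, ← Finset.sum_add_distrib]
    refine Finset.sum_le_sum fun s _ => ?_
    have := mul_le_mul_of_nonneg_left (h.V_sub_V_succ_le hL k πstar hTu s) (ρ.2.1 s)
    change ρ s * _ ≤ ρ s * _ at this
    linarith
  have hd := hstar.weightedNorm_sub (π k)
  have hd' := hstar.weightedNorm_sub (π (k + 1))
  have hmono := h.avgV_le_avgV_succ hL ρ k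
  have hd0 : 0 ≤ mdp.avgV ρ πstar - mdp.avgV ρ (π (k + 1)) := sub_nonneg.2 (hstar _)
  set d := mdp.avgV ρ πstar - mdp.avgV ρ (π k)
  set d' := mdp.avgV ρ πstar - mdp.avgV ρ (π (k + 1))
  have hdd : d' ≤ d := by simp only [d, d']; linarith
  have hdnn : 0 ≤ d := hd0.trans hdd
  clear_value d d'
  have hbound : ∑ s, ρ s * u s ≤ Ltilde * M * d ^ p := by
    rw [hd'] at hLip
    have h1 := weightedNorm_mulVec_le ρ (mul_nonneg hLtilde.le (Real.rpow_nonneg hd0 _)) hLip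
      (mdp.V πstar - mdp.V (π k))
    have h2 := weightedNorm_mulVec_le ρ hM.le hInv
      ((mdp.T (π (k + 1)) - mdp.T πstar).mulVec (mdp.V πstar - mdp.V (π k)))
    rw [← neg_sub (mdp.V (π k)), weightedNorm_neg, hd, neg_sub] at h1
    calc ∑ s, ρ s * u s ≤ weightedNorm ρ u := sum_le_weightedNorm ρ u
      _ ≤ M * (Ltilde * d' ^ (p - 1) * d) := h2.trans (mul_le_mul_of_nonneg_left h1 hM.le)
      _ ≤ M * (Ltilde * d ^ (p - 1) * d) := by
        gcongr
      _ = Ltilde * M * (d ^ (p - 1) * d) := by ring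
      _ = _ := by
        rw [← Real.rpow_add_one' hdnn (by linarith), sub_add_cancel]
  refine hsum.trans ?_
  gcongr
  linarith

end DiscountedMDP

theorem mainTheorem5 {S A : Type*} [Fintype S] [Fintype A] [DecidableEq S]
    [MeasurableSpace S] [MeasurableSingletonClass S]
    [MeasurableSpace A] [MeasurableSingletonClass A]
    (mdp : DiscountedMDP S A) (ρ : stdSimplex ℝ S)
    (πstar : Policy S A) (hstar : mdp.IsOptimal ρ πstar)
    (p : ℝ) (hp1 : 1 < p) (hp2 : p ≤ 2) (L : ℝ) (hL : 0 < L)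
    (η : ℕ → ℝ) (π : ℕ → Policy S A)
    (hNPG : mdp.IsAdaptiveNPG (fun k => L * p ^ k) η π)
    (Ltilde M : ℝ) (hLtilde : 0 < Ltilde) (hM : 0 < M)
    (hLip : ∀ k, inducedNorm ρ (mdp.T (π k) - mdp.T πstar) ≤
      ENNReal.ofReal (Ltilde * weightedNorm ρ (mdp.V (π k) - mdp.V πstar) ^ (p - 1)))
    (hInv : ∀ k, inducedNorm ρ (mdp.T (π k))⁻¹ ≤ ENNReal.ofReal M) :
    (∀ k : ℕ, |mdp.avgV ρ πstar - mdp.avgV ρ (π k)| ≤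
      Real.exp (p ^ k * max (rateExponent (Ltilde * M) p) 0) *
        (|mdp.avgV ρ πstar - mdp.avgV ρ (π 0)| ^ (p ^ k) +
          k * Real.exp (p ^ k * (-Real.log (1 - mdp.discount) - L)))) ∧
    (|mdp.avgV ρ πstar - mdp.avgV ρ (π 0)| < Real.exp (-rateExponent (Ltilde * M) p) →
      rateExponent (Ltilde * M) p - Real.log (1 - mdp.discount) < L →
      ConvergesSuperlinearly p
        (fun k => mdp.avgV ρ πstar - mdp.avgV ρ (π k))) := by
  have hp0 : 0 < p := zero_lt_one.trans hp1
  have hLk : ∀ k : ℕ, 0 < L * p ^ k := fun k => by positivity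
  have hb : 0 < Ltilde * M := mul_pos hLtilde hM
  have hd : ∀ k, 0 ≤ mdp.avgV ρ πstar - mdp.avgV ρ (π k) := fun k => sub_nonneg.2 (hstar _)
  have hanti : Antitone fun k => mdp.avgV ρ πstar - mdp.avgV ρ (π k) :=
    antitone_nat_of_succ_le fun k => by
      have := hNPG.avgV_le_avgV_succ hLk ρ k
      linarith
  have hrec := fun k => hNPG.avgV_error_succ_le hLk hstar hp1 hLtilde hM k (hLip (k + 1))
    (hInv (k + 1))
  simp only [abs_of_nonneg (hd 0), abs_of_nonneg (hd _)]
  set κ := rateExponent (Ltilde * M) p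
  set d : ℕ → ℝ := fun k => mdp.avgV ρ πstar - mdp.avgV ρ (π k) with hd_def
  have hκ : Ltilde * M * 2 ≤ Real.exp κ ^ (p - 1) := mul_two_le_exp_rateExponent hb hp1
  have hexpL : Real.exp (-L) < 1 := Real.exp_lt_one_iff.2 (neg_neg_of_pos hL)
  have hx : ∀ q, Real.exp (-L) ≤ q → ∀ k : ℕ, Real.exp (-(L * p ^ k)) / 2 ≤ q ^ p ^ k / 2 := by
    intro q hq k
    rw [← neg_mul, Real.exp_mul]
    gcongr
  have rate : ∀ D : ℝ, 0 < D → Ltilde * M * 2 ≤ D ^ (p - 1) → D * d 0 < 1 → ∀ k,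
      D * d k ≤ max (D * d 0) (Real.exp (-L)) ^ p ^ k := fun D hD hbD h1 =>
    mul_le_rpow_pow_of_recursion hp1 hp2 hd (fun k => by positivity) (hx _ (le_max_right _ _))
      hb.le hD hbD (lt_max_of_lt_right (Real.exp_pos _)) (max_lt h1 hexpL).le (le_max_left _ _) hrec
  constructor
  · intro k
    set D := Real.exp (max κ 0) with hD_def
    have hD : 0 < D := Real.exp_pos _
    have hD1 : 1 ≤ D := Real.one_le_exp (le_max_right _ _)
    have hbD : Ltilde * M * 2 ≤ D ^ (p - 1) := by
      refine hκ.trans (Real.rpow_le_rpow (Real.exp_pos _).le ?_ (by linarith))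
      exact Real.exp_le_exp.2 (le_max_left _ _)
    have hDpow : Real.exp (p ^ k * max κ 0) = D ^ p ^ k := by
      rw [mul_comm, Real.exp_mul]
    have hpk : 1 ≤ p ^ k := one_le_pow₀ hp1.le
    have hle : d k ≤ D * d k := le_mul_of_one_le_left (hd k) hD1
    set a := Real.exp (p ^ k * (-Real.log (1 - mdp.discount) - L)) with ha_def
    have ha : 0 < a := Real.exp_pos _
    rw [hDpow]
    change d k ≤ D ^ p ^ k * (d 0 ^ p ^ k + k * a)
    have hDd0 : (D * d 0) ^ p ^ k ≤ D ^ p ^ k * (d 0 ^ p ^ k + k * a) := by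
      rw [Real.mul_rpow hD.le (hd 0)]
      gcongr
      exact le_add_of_nonneg_right (by positivity)
    rcases le_or_gt 1 (D * d 0) with h1 | h1
    -- Here the bound exceeds `d 0`, and the errors do not increase.
    · refine le_trans ?_ hDd0
      calc d k ≤ d 0 := hanti (Nat.zero_le k)
        _ ≤ D * d 0 := le_mul_of_one_le_left (hd 0) hD1
        _ ≤ _ := Real.self_le_rpow_of_one_le h1 hpk
    · have h2 := hle.trans (rate D hD hbD h1 k)
      rcases le_total (Real.exp (-L)) (D * d 0) with h3 | h3
      · rw [max_eq_left h3] at h2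
        exact h2.trans hDd0
      · rw [max_eq_right h3] at h2
        rcases Nat.eq_zero_or_pos k with rfl | hk
        · refine le_trans ?_ hDd0
          simpa using hle
        · have hk1 : (1 : ℝ) ≤ k := by exact_mod_cast hk
          have hlog : Real.log (1 - mdp.discount) ≤ 0 :=
            Real.log_nonpos (by linarith [mdp.discount_lt_one]) (by linarith [mdp.discount_pos])
          have h4 : Real.exp (-L) ^ p ^ k ≤ a := by
            rw [← Real.exp_mul, ha_def, Real.exp_le_exp, mul_comm]
            gcongr
            linarith
          calc d k ≤ 1 * (0 + 1 * a) := by linarith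
            _ ≤ _ := by
              have h5 : 0 ≤ d 0 ^ p ^ k := Real.rpow_nonneg (hd 0) _
              have h6 : 1 ≤ D ^ p ^ k := Real.one_le_rpow hD1 (by linarith)
              gcongr
  · intro h0 _
    have hD := Real.exp_pos κ
    have h1 : Real.exp κ * d 0 < 1 := by
      calc Real.exp κ * d 0 < Real.exp κ * Real.exp (-κ) := by gcongr
        _ = 1 := by rw [← Real.exp_add, add_neg_cancel, Real.exp_zero]
    have hrate := rate _ hD hκ h1
    set q := max (Real.exp κ * d 0) (Real.exp (-L))
    have hq : 0 < q := lt_max_of_lt_right (Real.exp_pos _)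
    refine ⟨fun k => q ^ p ^ k / Real.exp κ, Real.exp κ ^ (p - 1), fun k => by positivity, ?_,
      fun k => ?_, fun k => ?_⟩
    · simpa using (tendsto_rpow_pow_atTop hp1 hq (max_lt h1 hexpL)).div_const (Real.exp κ)
    · refine le_of_eq ?_
      rw [Real.div_rpow (by positivity) hD.le, ← Real.rpow_mul hq.le, ← pow_succ,
        Real.rpow_sub_one hD.ne']
      field_simp
    · rw [abs_of_nonneg (hd k), le_div_iff₀ hD, mul_comm]
      exact hrate k
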